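/- **Garden-hose model.** A garden-hose protocol of size $s$ for inputs $(x,y)\in X\times Y$ has a set $V$ of $s$ vertices (the pipes) and one extra vertex $t$ (the tap). It assigns to every $x\in X$ a matching $E_A(x)$ (a set of pairwise disjoint edges) on $V\cup\{t\}$ and to every $y\in Y$ a matching $E_B(y)$ on $V$. In the graph $(V\cup\{t\},E_A(x)\cup E_B(y))$ there is a unique maximal path starting at $t$. The protocol computes $f:X\times Y\to\{0,1\}$ if for all $x,y$ the length of this path is even if and only if $f(x,y)=0$. The pipes in the connected component of $t$ (equivalently, those on this path) are called wet, and the protocol uses time at most $T$ if for every input $(x,y)$ at most $T$ pipes are wet. **Pointer jumping.** Let $U,V$ be disjoint sets of $n\ge 1$ vertices each, both numbered $1,\dots,n$; the binary name of a vertex is the binary representation of its number. Fix $v_0\in U$. For bijections $f_A:U\to V$ and $f_B:V\to U$ let $f:U\cup V\to U\cup V$ be the map that equals $f_A$ on $U$ and $f_B$ on $V$, and let $f_k$ be its $k$-th iterate. Then $PJ_k(f_A,f_B)\in\{0,1\}$ is the XOR of all bits in the binary name of $f_k(v_0)$. Alice receives $f_A$ and Bob receives $f_B$. **Theorem.** 1.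 For all $n,k\ge 1$ and every $v_0$, $PJ_k$ can be computed by a garden-hose protocol of size $kn$ that uses time at most $k$. 2. There is an absolute constant $c>0$ such that for all $n\ge 2$, all $k\ge 1$ with $k\le n/(100\log_2 n)$ and every $v_0$: every garden-hose protocol that computes $PJ_k$ and uses time at most $k-1$ has size at least $2^{c\,n/k}$. -/

import Mathlib

/-! ### The garden-hose model -/

namespace GardenHose

/-- A matching, given as a graph (its set of edges): no vertex lies on two different edges. -/
def IsMatching {W : Type*} (M : SimpleGraph W) : Prop :=
  ∀ u v w, M.Adj u v → M.Adj u w → v = w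

/-- A garden-hose protocol with `s` pipes for inputs `x : X` (Alice) and `y : Y` (Bob).
The pipes are the elements of `Fin s`. The vertices of Alice's matching are the pipes `some i`
together with the tap `none`; Bob's matching only involves the pipes. -/
structure Protocol (X Y : Type*) (s : ℕ) where
  /-- Alice's edges `E_A(x)`, among the pipes and the tap -/
  alice : X → SimpleGraph (Option (Fin s))
  /-- Bob's edges `E_B(y)`, among the pipes -/
  bob : Y → SimpleGraph (Fin s)
  alice_matching : ∀ x, IsMatching (alice x)
  bob_matching : ∀ y, IsMatching (bob y)

namespace Protocol

variable {X Y : Type*} {s : ℕ}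

/-- The graph on the pipes and the tap whose edges are those of Alice and those of Bob. (If the
two players choose the same edge, its two end points are joined to nothing else, so that edge is
not in the component of the tap.) -/
def graph (P : Protocol X Y s) (x : X) (y : Y) : SimpleGraph (Option (Fin s)) :=
  P.alice x ⊔ (P.bob y).map Function.Embedding.some

/-- The walk `p` from the tap is the path of the water: it is a path and ends where it cannot be
continued. -/
structure IsWaterPath (P : Protocol X Y s) (x : X) (y : Y) {v : Option (Fin s)}
    (p : (P.graph x y).Walk none v) : Prop where
  isPath : p.IsPath
  maximal : ∀ w, (P.graph x y).Adj v w → w ∈ p.support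

theorem exists_waterPath (P : Protocol X Y s) (x : X) (y : Y) :
    ∃ (v : Option (Fin s)) (p : (P.graph x y).Walk none v), P.IsWaterPath x y p := by
  classical
  by_contra hcon
  have key : ∀ m : ℕ, ∃ (v : Option (Fin s)) (p : (P.graph x y).Walk none v),
      p.IsPath ∧ p.length = m := by
    intro m
    induction m with
    | zero => exact ⟨none, .nil, by simp, by simp⟩
    | succ m ih =>
      obtain ⟨v, p, hp, hm⟩ := ih
      have : ∃ w, (P.graph x y).Adj v w ∧ w ∉ p.support := by
        by_contra h
        push Not at h
        exact hcon ⟨v, p, hp, h⟩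
      obtain ⟨w, hw, hwp⟩ := this
      exact ⟨w, p.concat hw, hp.concat hwp hw, by simp [hm]⟩
  obtain ⟨v, p, hp, hm⟩ := key (Fintype.card (Option (Fin s)))
  exact absurd hp.length_lt (by omega)

/-- Length of the path of the water; it does not depend on the choice, by `waterPath_length`. -/
noncomputable def pathLength (P : Protocol X Y s) (x : X) (y : Y) : ℕ :=
  (P.exists_waterPath x y).choose_spec.choose.length

theorem nbr_unique (P : Protocol X Y s) (x : X) (y : Y) {u a b c : Option (Fin s)}
    (ha : (P.graph x y).Adj u a) (hb : (P.graph x y).Adj u b) (hc : (P.graph x y).Adj u c)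
    (hab : b ≠ a) (hac : c ≠ a) : b = c := by
  have hB : ∀ u v w, ((P.bob y).map Function.Embedding.some).Adj u v →
      ((P.bob y).map Function.Embedding.some).Adj u w → v = w := by
    rintro u v w h1 h2
    rw [SimpleGraph.map_adj] at h1 h2
    obtain ⟨i, j, h, rfl, rfl⟩ := h1
    obtain ⟨i', j', h', hi, rfl⟩ := h2
    have : i' = i := by simpa using hi
    subst this
    rw [P.bob_matching y _ _ _ h h']
  have hA := P.alice_matching x
  simp only [graph, SimpleGraph.sup_adj] at ha hb hc
  rcases ha with ha | ha <;> rcases hb with hb | hb <;> rcases hc with hc | hc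
  · exact hA _ _ _ hb hc
  · exact absurd (hA _ _ _ hb ha) hab
  · exact absurd (hA _ _ _ hc ha) hac
  · exact hB _ _ _ hb hc
  · exact hA _ _ _ hb hc
  · exact absurd (hB _ _ _ hc ha) hac
  · exact absurd (hB _ _ _ hb ha) hab
  · exact hB _ _ _ hb hc

theorem tap_nbr_unique (P : Protocol X Y s) (x : X) (y : Y) {b c : Option (Fin s)}
    (hb : (P.graph x y).Adj none b) (hc : (P.graph x y).Adj none c) : b = c := by
  simp only [graph, SimpleGraph.sup_adj, SimpleGraph.map_adj] at hb hc
  rcases hb with hb | ⟨i, j, _, hi, _⟩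
  · rcases hc with hc | ⟨i, j, _, hi, _⟩
    · exact P.alice_matching x _ _ _ hb hc
    · simp at hi
  · simp at hi

theorem getVert_eq (P : Protocol X Y s) (x : X) (y : Y) {v w : Option (Fin s)}
    {p : (P.graph x y).Walk none v} {q : (P.graph x y).Walk none w}
    (hp : p.IsPath) (hq : q.IsPath) :
    ∀ i, i ≤ p.length → i ≤ q.length → p.getVert i = q.getVert i := by
  intro i
  induction i using Nat.strong_induction_on with
  | _ i ih =>
    intro h1 h2
    match i, ih, h1, h2 with
    | 0, _, _, _ => simp
    | 1, _, h1, h2 =>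
      have a := p.adj_getVert_succ (i := 0) (by omega)
      have b := q.adj_getVert_succ (i := 0) (by omega)
      simp only [SimpleGraph.Walk.getVert_zero] at a b
      exact P.tap_nbr_unique x y a b
    | j + 2, ih, h1, h2 =>
      have e0 := ih j (by omega) (by omega) (by omega)
      have e1 := ih (j + 1) (by omega) (by omega) (by omega)
      have a0 := (p.adj_getVert_succ (i := j) (by omega)).symm
      have a := p.adj_getVert_succ (i := j + 1) (by omega)
      have b := q.adj_getVert_succ (i := j + 1) (by omega)
      rw [← e1] at b
      refine P.nbr_unique x y a0 a b ?_ ?_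
      · intro h
        have := hp.getVert_injOn (by simp; omega) (by simp; omega) h
        omega
      · intro h
        rw [e0] at h
        have := hq.getVert_injOn (by simp; omega) (by simp; omega) h
        omega

theorem length_le (P : Protocol X Y s) (x : X) (y : Y) {v w : Option (Fin s)}
    {p : (P.graph x y).Walk none v} {q : (P.graph x y).Walk none w}
    (hp : P.IsWaterPath x y p) (hq : P.IsWaterPath x y q) : q.length ≤ p.length := by
  by_contra hlt
  push Not at hlt
  have e := P.getVert_eq x y hp.isPath hq.isPath p.length le_rfl hlt.le
  have a := q.adj_getVert_succ hlt
  rw [← e, SimpleGraph.Walk.getVert_length] at a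
  obtain ⟨i, hi, hle⟩ := SimpleGraph.Walk.mem_support_iff_exists_getVert.1 (hp.maximal _ a)
  rw [P.getVert_eq x y hp.isPath hq.isPath i hle (by omega)] at hi
  have := hq.isPath.getVert_injOn (by simp; omega) (by simp; omega) hi
  omega

theorem waterPath_length (P : Protocol X Y s) (x : X) (y : Y) {v : Option (Fin s)}
    {p : (P.graph x y).Walk none v} (hp : P.IsWaterPath x y p) :
    P.pathLength x y = p.length :=
  le_antisymm (P.length_le x y hp (P.exists_waterPath x y).choose_spec.choose_spec)
    (P.length_le x y (P.exists_waterPath x y).choose_spec.choose_spec hp)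

/-- The protocol computes `f`: the path of the water has even length iff `f x y` is `0`. -/
def Computes (P : Protocol X Y s) (f : X → Y → Bool) : Prop :=
  ∀ x y, Even (P.pathLength x y) ↔ f x y = false

/-- The pipes that carry water on input `x, y`: those connected to the tap. -/
def wetPipes (P : Protocol X Y s) (x : X) (y : Y) : Set (Fin s) :=
  {i | (P.graph x y).Reachable none (some i)}

/-- The protocol uses time at most `T`: on every input, at most `T` pipes are wet. -/
def TimeAtMost (P : Protocol X Y s) (T : ℕ) : Prop :=
  ∀ x y, (P.wetPipes x y).ncard ≤ T

end Protocol

end GardenHose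

/-! ### Pointer jumping on bijections -/

namespace PointerJumping

/-- The map `f` on the disjoint union of `U` and `V` (both with `n` vertices) that is `f_A` on `U`
and `f_B` on `V`. -/
def jump {n : ℕ} (fA fB : Fin n ≃ Fin n) : Fin n ⊕ Fin n → Fin n ⊕ Fin n
  | .inl u => .inr (fA u)
  | .inr v => .inl (fB v)

/-- The vertices of `U`, and likewise those of `V`, are numbered from `1` to `n`. -/
def number {n : ℕ} : Fin n ⊕ Fin n → ℕ
  | .inl u => u.val + 1
  | .inr v => v.val + 1

/-- The XOR of all bits of the binary representation of a number. -/
def xorBits (m : ℕ) : Bool := m.bits.foldr xor false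

/-- Pointer jumping `PJ_k` with start vertex `v₀ ∈ U`: the XOR of all bits in the binary name of
the vertex reached after `k` steps. -/
def PJ {n : ℕ} (k : ℕ) (v₀ : Fin n) (fA fB : Fin n ≃ Fin n) : Bool :=
  xorBits (number ((jump fA fB)^[k] (.inl v₀)))

end PointerJumping

/-! Upper bound: `k` levels of `n` pipes let the water follow the pointers. The last level is
entered only when this gives the path length the parity of the answer.

Lower bound: from the tap on, the water uses edges of Alice and of Bob alternately, so its course is
a conversation: each step depends on the current position and on one player's input. With `s` pipes
there are `s + 2` possible states (a pipe, the tap, stopped), and at most `k - 1` wet pipes means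
that `k - 1` steps determine the path length. It remains to see that a conversation of `k - 1` such
messages, begun by Alice, cannot determine the parity of the vertex after `k` jumps
(`exists_run_eq_and_xorBits_ne`).

An adversary keeps for each player a set `S` of bijections that agree on a set `F` of points and are
spread outside `F`: no value is 3/2 times as likely as under uniform choice. In each step the next
pointer value and the message are fixed, which divides the potential `weight` by at most `6 * (s +
2)`; spreadness is then restored by fixing overly likely values, at no loss of potential
(`exists_spread`). Since the potential is at most `(2/3) ^ |F|`, `F` stays small. So the next
pointer can always be sent outside the other player's `F` (`Fixed.exists_succ`), and in the end both
parities are still possible. -/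

namespace GardenHose

/-! ### The course of the water as an alternating process -/

/-- The vertex matched to `v`, if there is one. -/
noncomputable def partner {W : Type*} (M : SimpleGraph W) (v : W) : Option W :=
  open Classical in if h : ∃ w, M.Adj v w then some h.choose else none

theorem partner_eq_some {W : Type*} {M : SimpleGraph W} (hM : IsMatching M) {v w : W} :
    partner M v = some w ↔ M.Adj v w := by
  unfold partner
  constructor
  · intro h
    split_ifs at h with h'
    rw [← Option.some.inj h]
    exact h'.choose_spec
  · intro h
    have h' : ∃ w, M.Adj v w := ⟨w, h⟩
    rw [dif_pos h', hM _ _ _ h'.choose_spec h]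

theorem IsMatching.map_some {W : Type*} {M : SimpleGraph W} (hM : IsMatching M) :
    IsMatching (M.map Function.Embedding.some) := by
  rintro u v w h1 h2
  rw [SimpleGraph.map_adj] at h1 h2
  obtain ⟨i, j, h, rfl, rfl⟩ := h1
  obtain ⟨i', j', h', hi, rfl⟩ := h2
  have : i' = i := by simpa using hi
  subst this
  rw [hM _ _ _ h h']

namespace Protocol

variable {X Y : Type*} {s : ℕ}

/-- The matching that contains the edge number `j` (counted from `0`) of the path of the water. -/
def edges (P : Protocol X Y s) (x : X) (y : Y) (j : ℕ) : SimpleGraph (Option (Fin s)) :=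
  bif j.bodd then (P.bob y).map Function.Embedding.some else P.alice x

/-- The vertex that the water reaches after `j` edges, or `none` if it stops before. -/
noncomputable def flow (P : Protocol X Y s) (x : X) (y : Y) : ℕ → Option (Option (Fin s))
  | 0 => some none
  | j + 1 => (P.flow x y j).bind (partner (P.edges x y j))

variable (P : Protocol X Y s) (x : X) (y : Y)

theorem edges_isMatching (j : ℕ) : IsMatching (P.edges x y j) := by
  unfold edges
  cases j.bodd
  · exact P.alice_matching x
  · exact (P.bob_matching y).map_some

theorem edges_le_graph (j : ℕ) : P.edges x y j ≤ P.graph x y := by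
  unfold edges graph
  cases j.bodd
  · exact le_sup_left
  · exact le_sup_right

theorem edges_add_two (j : ℕ) : P.edges x y (j + 2) = P.edges x y j := by
  simp [edges]

theorem edges_add_two_mul (j d : ℕ) : P.edges x y (j + 2 * d) = P.edges x y j := by
  simp [edges]

theorem graph_adj_edges (j : ℕ) {v w : Option (Fin s)} (h : (P.graph x y).Adj v w) :
    (P.edges x y j).Adj v w ∨ (P.edges x y (j + 1)).Adj v w := by
  rw [graph, SimpleGraph.sup_adj] at h
  unfold edges
  rw [Nat.bodd_succ]
  cases j.bodd
  · exact h
  · exact h.symm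

theorem not_edges_adj_tap {j : ℕ} (hj : j.bodd = true) {v : Option (Fin s)} :
    ¬ (P.edges x y j).Adj none v := by
  simp only [edges, hj, cond_true, SimpleGraph.map_adj]
  rintro ⟨_, _, _, h, _⟩
  cases h

theorem flow_succ_eq_some {j : ℕ} {w : Option (Fin s)} :
    P.flow x y (j + 1) = some w ↔ ∃ v, P.flow x y j = some v ∧ (P.edges x y j).Adj v w := by
  simp [flow, Option.bind_eq_some_iff, partner_eq_some (P.edges_isMatching x y j)]

variable {P x y}

/-- At odd distance the edge leaving the first visit and the edge entering the second belong to the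
same matching. Hence the two visits can be moved towards each other until an edge would be a loop.
-/
theorem flow_ne_odd (d : ℕ) : ∀ {i : ℕ} {v : Option (Fin s)}, P.flow x y i = some v →
    P.flow x y (i + 2 * d + 1) ≠ some v := by
  induction d with
  | zero =>
    intro i v h h'
    obtain ⟨u, hu, ha⟩ := (P.flow_succ_eq_some x y).1 h'
    rw [h, Option.some_inj] at hu
    exact ha.ne hu.symm
  | succ d ih =>
    intro i v h h'
    obtain ⟨u, hu, ha⟩ := (P.flow_succ_eq_some x y).1 h'
    rw [edges_add_two_mul] at ha
    have h1 : P.flow x y (i + 1) = some u := (P.flow_succ_eq_some x y).2 ⟨v, h, ha.symm⟩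
    refine ih h1 ?_
    rw [← hu]
    congr 1
    ring

/-- At even distance both visits are entered through the same matching, so both can be moved back
until the first is at the tap. The second would then enter the tap through an edge of Bob. -/
theorem flow_ne_even (d : ℕ) : ∀ {i : ℕ} {v : Option (Fin s)}, P.flow x y i = some v →
    P.flow x y (i + 2 * d + 2) ≠ some v := by
  intro i
  induction i with
  | zero =>
    intro v h h'
    obtain ⟨u, hu, ha⟩ := (P.flow_succ_eq_some x y).1 h'
    obtain rfl : none = v := Option.some.inj h
    exact P.not_edges_adj_tap x y (by simp) ha.symm
  | succ i ih =>
    intro v h h'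
    obtain ⟨u, hu, ha⟩ := (P.flow_succ_eq_some x y).1 h
    obtain ⟨u', hu', ha'⟩ := (P.flow_succ_eq_some x y).1 h'
    have e : i + 1 + 2 * d + 1 = i + 2 * (d + 1) := by ring
    rw [e, edges_add_two_mul] at ha'
    obtain rfl := P.edges_isMatching x y i _ _ _ ha.symm ha'.symm
    refine ih hu ?_
    rw [← hu']
    congr 1
    ring

theorem flow_injective {i j : ℕ} {v : Option (Fin s)} (hi : P.flow x y i = some v)
    (hj : P.flow x y j = some v) : i = j := by
  wlog hij : i ≤ j generalizing i j
  · exact (this hj hi (by omega)).symm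
  by_contra hne
  obtain ⟨d, hd | hd⟩ := Nat.even_or_odd' (j - i)
  · exact flow_ne_even (d - 1) hi (by rwa [show i + 2 * (d - 1) + 2 = j by omega])
  · exact flow_ne_odd d hi (by rwa [show i + 2 * d + 1 = j by omega])

theorem exists_path_of_flow {m : ℕ} : ∀ {v : Option (Fin s)}, P.flow x y m = some v →
    ∃ p : (P.graph x y).Walk none v, p.IsPath ∧ p.length = m ∧
      ∀ u, u ∈ p.support ↔ ∃ i ≤ m, P.flow x y i = some u := by
  induction m with
  | zero =>
    intro v h
    obtain rfl : none = v := Option.some.inj h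
    exact ⟨.nil, by simp, by simp, by simp [flow, eq_comm]⟩
  | succ m ih =>
    intro v h
    obtain ⟨u, hu, ha⟩ := (P.flow_succ_eq_some x y).1 h
    obtain ⟨p, hp, hl, hs⟩ := ih hu
    refine ⟨p.concat (P.edges_le_graph x y m ha), hp.concat ?_ _, by simp [hl], fun w => ?_⟩
    · intro hv
      obtain ⟨i, hi, hiv⟩ := (hs v).1 hv
      have := flow_injective hiv h
      omega
    · rw [SimpleGraph.Walk.support_concat, List.mem_append, hs,
        List.mem_singleton]
      constructor
      · rintro (⟨i, hi, hiw⟩ | rfl)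
        · exact ⟨i, by omega, hiw⟩
        · exact ⟨m + 1, le_rfl, h⟩
      · rintro ⟨i, hi, hiw⟩
        rcases Nat.le_succ_iff.1 hi with hi | rfl
        · exact Or.inl ⟨i, hi, hiw⟩
        · right
          rw [h, Option.some_inj] at hiw
          exact hiw.symm

/-- One matching leads from a visited vertex to its successor, the other to its predecessor. Thus
the visited vertices form the whole component of the tap. -/
theorem flow_adj_closed {m : ℕ} (hm : P.flow x y (m + 1) = none) {i : ℕ} (hi : i ≤ m)
    {v w : Option (Fin s)} (hv : P.flow x y i = some v) (h : (P.graph x y).Adj v w) :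
    ∃ j ≤ m, P.flow x y j = some w := by
  rcases P.graph_adj_edges x y i h with h | h
  · have hw := (P.flow_succ_eq_some x y).2 ⟨v, hv, h⟩
    refine ⟨i + 1, ?_, hw⟩
    by_contra hc
    obtain rfl : i = m := by omega
    rw [hm] at hw
    cases hw
  · cases i with
    | zero =>
      obtain rfl : none = v := Option.some.inj hv
      exact absurd h (P.not_edges_adj_tap x y (by simp))
    | succ i =>
      obtain ⟨u, hu, ha⟩ := (P.flow_succ_eq_some x y).1 hv
      rw [edges_add_two] at h
      obtain rfl := P.edges_isMatching x y i _ _ _ ha.symm h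
      exact ⟨i, by omega, hu⟩

theorem pathLength_eq {m : ℕ} {v : Option (Fin s)} (hv : P.flow x y m = some v)
    (hm : P.flow x y (m + 1) = none) : P.pathLength x y = m := by
  obtain ⟨p, hp, hl, hs⟩ := exists_path_of_flow hv
  rw [← hl]
  exact P.waterPath_length x y
    ⟨hp, fun w hw => (hs w).2 (flow_adj_closed hm le_rfl hv hw)⟩

theorem flow_eq_none_of_le {i j : ℕ} (hij : i ≤ j) (hi : P.flow x y i = none) :
    P.flow x y j = none := by
  induction j, hij using Nat.le_induction with
  | base => exact hi
  | succ j _ ih => simp [flow, ih]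

variable (P x y)

theorem exists_flow_end : ∃ (m : ℕ) (v : Option (Fin s)), P.flow x y m = some v ∧
    P.flow x y (m + 1) = none := by
  classical
  have hex : ∃ m, P.flow x y m = none := by
    by_contra h
    push Not at h
    obtain ⟨v, hv⟩ := Option.ne_none_iff_exists'.1 (h (Fintype.card (Option (Fin s))))
    obtain ⟨p, hp, hl, -⟩ := exists_path_of_flow hv
    exact absurd hp.length_lt (by omega)
  have h0 : Nat.find hex ≠ 0 := fun h => by
    have := Nat.find_spec hex
    rw [h] at this
    cases this
  obtain ⟨m, hm⟩ := Nat.exists_eq_succ_of_ne_zero h0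
  obtain ⟨v, hv⟩ := Option.ne_none_iff_exists'.1 (Nat.find_min hex (m := m) (by omega))
  refine ⟨m, v, hv, ?_⟩
  have := Nat.find_spec hex
  rwa [hm] at this

theorem flow_eq_none_iff (j : ℕ) : P.flow x y j = none ↔ P.pathLength x y < j := by
  obtain ⟨m, v, hv, hm⟩ := P.exists_flow_end x y
  rw [pathLength_eq hv hm]
  constructor
  · intro h
    by_contra hc
    rw [flow_eq_none_of_le (not_lt.1 hc) h] at hv
    cases hv
  · intro h
    exact flow_eq_none_of_le h hm

theorem ncard_wetPipes : (P.wetPipes x y).ncard = P.pathLength x y := by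
  classical
  obtain ⟨m, v, hv, hm⟩ := P.exists_flow_end x y
  rw [pathLength_eq hv hm]
  obtain ⟨p, hp, hl, hs⟩ := exists_path_of_flow hv
  have hreach : ∀ w, (P.graph x y).Reachable none w ↔ w ∈ p.support := by
    intro w
    constructor
    · rintro ⟨q⟩
      have key : ∀ a b, (q : (P.graph x y).Walk a b) → a ∈ p.support → b ∈ p.support := by
        intro a b q
        induction q with
        | nil => exact id
        | cons hadj _ ih =>
          intro ha
          obtain ⟨i, hi, hia⟩ := (hs _).1 ha
          exact ih ((hs _).2 (flow_adj_closed hm hi hia hadj))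
      exact key _ _ q p.start_mem_support
    · intro hw
      exact ⟨p.takeUntil w hw⟩
  have himage : some '' P.wetPipes x y = ↑(p.support.toFinset.erase none) := by
    ext w
    cases w <;> simp [wetPipes, hreach]
  rw [← Set.ncard_image_of_injective _ (Option.some_injective _), himage, Set.ncard_coe_finset,
    Finset.card_erase_of_mem (by simp), List.toFinset_card_of_nodup hp.support_nodup,
    SimpleGraph.Walk.length_support, hl, Nat.add_sub_cancel]

end Protocol

end GardenHose

/-! ### Alternating computations and the parity of binary digits -/

namespace PointerJumping

/-- A computation in which two players alternate: in step `j` the state is updated by the player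
`j.bodd`, who holds the input `z j.bodd`. -/
def run {I T : Type*} (step : ℕ → I → T → T) (t : T) (z : Bool → I) : ℕ → T
  | 0 => t
  | j + 1 => step j (z j.bodd) (run step t z j)

/-- The inputs of Alice and Bob, indexed by the players. -/
def inputs {I : Type*} (a b : I) : Bool → I := fun i => bif i then b else a

/-- The vertex reached after `j` jumps, without the information on its side. -/
def pointer {n : ℕ} (v₀ : Fin n) (z : Bool → (Fin n ≃ Fin n)) : ℕ → Fin n :=
  run (fun _ f v => f v) v₀ z

theorem number_jump_iterate {n : ℕ} (v₀ : Fin n) (fA fB : Fin n ≃ Fin n) (k : ℕ) :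
    number ((jump fA fB)^[k] (.inl v₀)) = (pointer v₀ (inputs fA fB) k : ℕ) + 1 := by
  have key : (jump fA fB)^[k] (.inl v₀) =
      bif k.bodd then .inr (pointer v₀ (inputs fA fB) k)
      else .inl (pointer v₀ (inputs fA fB) k) := by
    induction k with
    | zero => rfl
    | succ k ih =>
      rw [Function.iterate_succ_apply', ih, Nat.bodd_succ]
      rcases h : k.bodd <;> simp [jump, pointer, run, inputs, h]
  rw [key]
  cases k.bodd <;> rfl

theorem xorBits_two_mul (m : ℕ) : xorBits (2 * m) = xorBits m := by
  rcases Nat.eq_zero_or_pos m with rfl | h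
  · rfl
  · simp [xorBits, Nat.bit0_bits m h.ne']

theorem xorBits_two_mul_add_one (m : ℕ) : xorBits (2 * m + 1) = !xorBits m := by
  simp [xorBits]

theorem eq_of_div_two_eq_of_xorBits_eq {a b : ℕ} (h : a / 2 = b / 2)
    (hx : xorBits a = xorBits b) : a = b := by
  rcases Nat.even_or_odd' a with ⟨p, rfl | rfl⟩ <;> rcases Nat.even_or_odd' b with ⟨q, rfl | rfl⟩
  · omega
  · obtain rfl : p = q := by omega
    simp [xorBits_two_mul, xorBits_two_mul_add_one] at hx
  · obtain rfl : p = q := by omega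
    simp [xorBits_two_mul, xorBits_two_mul_add_one] at hx
  · omega

/-- The numbers `2 * m` and `2 * m + 1` have opposite parities, so each such pair contributes at
most one element. -/
theorem card_xorBits_eq_le (n : ℕ) (b : Bool) :
    (Finset.univ.filter fun w : Fin n => xorBits (w + 1) = b).card ≤ n / 2 + 1 := by
  rw [← Finset.card_range (n / 2 + 1)]
  refine Finset.card_le_card_of_injOn (fun w => (w.val + 1) / 2) ?_ ?_
  · intro w _
    have := w.isLt
    simp only [Finset.coe_range, Set.mem_Iio]
    omega
  · intro w hw w' hw' h
    simp only [Finset.coe_filter, Finset.mem_univ, true_and, Set.mem_ofPred_eq] at hw hw'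
    have := eq_of_div_two_eq_of_xorBits_eq h (hw.trans hw'.symm)
    exact Fin.ext (by omega)

/-! ### Spread sets of bijections and their weight -/

section Sets

variable {n : ℕ}

/-- All members of `S` agree on `F`. -/
def AgreeOn (S : Finset (Fin n ≃ Fin n)) (F : Finset (Fin n)) : Prop :=
  ∀ f ∈ S, ∀ g ∈ S, ∀ v ∈ F, f v = g v

/-- The members of `S` that map `v` to `w`. -/
def fiber (S : Finset (Fin n ≃ Fin n)) (v w : Fin n) : Finset (Fin n ≃ Fin n) :=
  S.filter fun f => f v = w

/-- Outside of `F`, no value of a random member of `S` is much more likely than it is for a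
random bijection with prescribed values on `F`. -/
def Spread (S : Finset (Fin n ≃ Fin n)) (F : Finset (Fin n)) : Prop :=
  ∀ v ∉ F, ∀ w, 2 * (n - F.card) * (fiber S v w).card < 3 * S.card

/-- The density of `S` among the bijections with prescribed values on `F`, scaled so that fixing
an unexpectedly likely value does not decrease it. -/
noncomputable def weight (S : Finset (Fin n ≃ Fin n)) (F : Finset (Fin n)) : ℝ :=
  S.card * (2 / 3) ^ F.card / (n - F.card).factorial

theorem AgreeOn.mono {S S' : Finset (Fin n ≃ Fin n)} {F : Finset (Fin n)} (h : AgreeOn S F)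
    (hS : S' ⊆ S) : AgreeOn S' F :=
  fun f hf g hg => h f (hS hf) g (hS hg)

theorem AgreeOn.fiber {S : Finset (Fin n ≃ Fin n)} {F : Finset (Fin n)} (h : AgreeOn S F)
    (v w : Fin n) : AgreeOn (fiber S v w) (insert v F) := by
  intro f hf g hg u hu
  simp only [PointerJumping.fiber, Finset.mem_filter] at hf hg
  rcases Finset.mem_insert.1 hu with rfl | hu
  · rw [hf.2, hg.2]
  · exact h f hf.1 g hg.1 u hu

theorem AgreeOn.card_le {S : Finset (Fin n ≃ Fin n)} {F : Finset (Fin n)} (h : AgreeOn S F) :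
    S.card ≤ (n - F.card).factorial := by
  rcases S.eq_empty_or_nonempty with rfl | ⟨g, hg⟩
  · simp
  have hc : Fintype.card {v // v ∉ F} = n - F.card := by
    rw [Fintype.card_subtype_compl]
    simp
  rw [← hc, ← Fintype.card_perm, ← Fintype.card_congr
    (Equiv.Perm.subtypeEquivSubtypePerm (fun v => v ∉ F)).symm, ← Fintype.card_coe S]
  refine Fintype.card_le_of_injective
    -- Relative to a fixed member `g`, every member of `S` becomes a permutation that fixes `F`
    -- pointwise.
    (fun f => ⟨g⁻¹ * f.1, fun v hv => ?_⟩) ?_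
  · rw [Equiv.Perm.mul_apply, h f.1 f.2 g hg v (not_not.1 hv), Equiv.Perm.inv_def, Equiv.symm_apply_apply]
  · intro f f' hff
    exact Subtype.ext (mul_left_cancel (Subtype.ext_iff.1 hff))

theorem AgreeOn.weight_le {S : Finset (Fin n ≃ Fin n)} {F : Finset (Fin n)} (h : AgreeOn S F) :
    weight S F ≤ (2 / 3) ^ F.card := by
  rw [weight, div_le_iff₀ (by positivity), mul_comm]
  gcongr
  exact h.card_le

theorem card_lt_of_notMem {F : Finset (Fin n)} {v : Fin n} (hv : v ∉ F) : F.card < n := by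
  have := Finset.card_lt_univ_of_notMem hv
  simpa using this

theorem weight_insert {S : Finset (Fin n ≃ Fin n)} {F : Finset (Fin n)} {v : Fin n}
    (hv : v ∉ F) :
    weight S (insert v F) =
      S.card * (2 / 3) ^ F.card / (n - F.card).factorial * (2 / 3 * (n - F.card : ℕ)) := by
  obtain ⟨m, hm⟩ : ∃ m, n - F.card = m + 1 := ⟨n - F.card - 1, by
    have := card_lt_of_notMem hv
    omega⟩
  rw [weight, Finset.card_insert_of_notMem hv, ← Nat.sub_sub, hm, Nat.add_sub_cancel,
    Nat.factorial_succ]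
  push_cast
  field_simp
  ring

/-- A value that violates spreadness keeps at least a fraction `3 / (2 * (n - |F|))` of `S`. Fixing
it multiplies the rest of the weight by `2 / 3 * (n - |F|)`, so nothing is lost. The process ends
because `F` grows. -/
theorem exists_spread (S : Finset (Fin n ≃ Fin n)) (F : Finset (Fin n)) (h : AgreeOn S F) :
    ∃ S' ⊆ S, ∃ F', AgreeOn S' F' ∧ Spread S' F' ∧ weight S F ≤ weight S' F' := by
  induction hm : n - F.card using Nat.strong_induction_on generalizing S F with
  | _ m ih =>
    by_cases hs : Spread S F
    · exact ⟨S, subset_rfl, F, h, hs, le_rfl⟩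
    · simp only [Spread, not_forall, not_lt] at hs
      obtain ⟨v, hv, w, hw⟩ := hs
      have hlt := card_lt_of_notMem hv
      obtain ⟨S', hS', F', h1, h2, h3⟩ := ih (n - (insert v F).card)
        (by rw [Finset.card_insert_of_notMem hv]; omega) (fiber S v w) (insert v F)
        (h.fiber v w) rfl
      refine ⟨S', hS'.trans (Finset.filter_subset _ _), F', h1, h2, le_trans ?_ h3⟩
      rw [weight_insert hv, weight, div_mul_eq_mul_div]
      gcongr ?_ / _
      have hw' : (3 : ℝ) * S.card ≤ 2 * (n - F.card : ℕ) * (fiber S v w).card := by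
        exact_mod_cast hw
      have hp : (0 : ℝ) < (2 / 3) ^ F.card := by positivity
      nlinarith

theorem sum_card_fiber (S : Finset (Fin n ≃ Fin n)) (v : Fin n) :
    ∑ w, (fiber S v w).card = S.card :=
  (Finset.card_eq_sum_card_fiberwise (f := fun f : Fin n ≃ Fin n => f v)
    (fun _ _ => Finset.mem_coe.2 (Finset.mem_univ _))).symm

theorem Spread.sum_card_fiber_le {S : Finset (Fin n ≃ Fin n)} {F : Finset (Fin n)}
    (hs : Spread S F) {v : Fin n} (hv : v ∉ F) (W : Finset (Fin n)) :
    2 * (n - F.card) * ∑ w ∈ W, (fiber S v w).card ≤ W.card * (3 * S.card) := by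
  rw [Finset.mul_sum, ← smul_eq_mul W.card]
  exact Finset.sum_le_card_nsmul _ _ _ fun w _ => (hs v hv w).le

/-- A value outside of a small set `G` that is not too unlikely. -/
theorem Spread.exists_fiber {S : Finset (Fin n ≃ Fin n)} {F G : Finset (Fin n)}
    (hs : Spread S F) {v : Fin n} (hv : v ∉ F) (hG : 3 * G.card ≤ n - F.card) :
    ∃ w ∉ G, S.card ≤ 2 * n * (fiber S v w).card := by
  have hlt := card_lt_of_notMem hv
  have hG' := hs.sum_card_fiber_le hv G
  have hsum := sum_card_fiber S v
  rw [← Finset.sum_add_sum_compl G] at hsum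
  set a := ∑ w ∈ G, (fiber S v w).card
  set b := ∑ w ∈ Gᶜ, (fiber S v w).card with hb
  -- Values in `G` account for at most half of `S`; the other half is shared by at most `n` values.
  have ha : 2 * a ≤ S.card := by
    have h1 : (n - F.card) * (2 * a) ≤ (n - F.card) * S.card := by
      calc (n - F.card) * (2 * a) = 2 * (n - F.card) * a := by ring
        _ ≤ 3 * G.card * S.card := by linarith
        _ ≤ _ := Nat.mul_le_mul_right _ hG
    exact Nat.le_of_mul_le_mul_left h1 (by omega)
  by_contra hcon
  push Not at hcon
  have hne : (Gᶜ).Nonempty := by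
    rw [← Finset.card_pos, Finset.card_compl, Fintype.card_fin]
    omega
  have h2 : 2 * n * b < (Gᶜ).card * S.card := by
    rw [hb, Finset.mul_sum, ← smul_eq_mul (Gᶜ).card, ← Finset.sum_const]
    exact Finset.sum_lt_sum_of_nonempty hne fun w hw => hcon w (Finset.mem_compl.1 hw)
  have h3 : (Gᶜ).card ≤ n := by simpa using Finset.card_le_univ (Gᶜ)
  have h4 : n * S.card ≤ n * (2 * b) := Nat.mul_le_mul_left _ (by omega)
  have h5 := Nat.mul_le_mul_right S.card h3
  linarith

/-- A spread set takes values of both parities. -/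
theorem Spread.exists_xorBits {S : Finset (Fin n ≃ Fin n)} {F : Finset (Fin n)}
    (hs : Spread S F) {v : Fin n} (hv : v ∉ F) (hF : 20 * F.card ≤ n) (hn : 20 ≤ n) (b : Bool) :
    ∃ f ∈ S, xorBits (f v + 1) = b := by
  by_contra hcon
  push Not at hcon
  -- The inequality in `Spread` is strict, so it excludes the empty set once a point lies outside
  -- `F`.
  have hpos : 0 < S.card := by
    have := hs v hv v
    omega
  have h1 := hs.sum_card_fiber_le hv (Finset.univ.filter fun w : Fin n => xorBits (w + 1) = !b)
  have h2 := card_xorBits_eq_le n (!b)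
  rw [Finset.sum_subset (Finset.subset_univ _), sum_card_fiber] at h1
  -- If one parity never occurred, about half of the values would carry all of `S`; spreadness
  -- allows them only about three quarters.
  · have h3 : 2 * (n - F.card) ≤ (n / 2 + 1) * 3 := by
      refine Nat.le_of_mul_le_mul_right (h1.trans ?_) hpos
      rw [mul_assoc]
      exact Nat.mul_le_mul_right _ h2
    omega
  · intro w _ hw
    rw [Finset.card_eq_zero, fiber, Finset.filter_eq_empty_iff]
    rintro f hf rfl
    have := hcon f hf
    simp only [Finset.mem_filter, Finset.mem_univ, true_and] at hw
    cases h : xorBits (f v + 1) <;> cases b <;> simp_all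

end Sets

end PointerJumping

/-! ### The protocol that follows the pointers -/

namespace GardenHose

theorem map_comap_some_adj {W : Type*} (G : SimpleGraph (Option W)) {a b : Option W} :
    ((G.comap some).map Function.Embedding.some).Adj a b ↔ G.Adj a b ∧ a ≠ none ∧ b ≠ none := by
  rw [SimpleGraph.map_adj]
  constructor
  · rintro ⟨i, j, h, rfl, rfl⟩
    exact ⟨h, by simp, by simp⟩
  · rintro ⟨h, ha, hb⟩
    obtain ⟨i, rfl⟩ := Option.ne_none_iff_exists'.1 ha
    obtain ⟨j, rfl⟩ := Option.ne_none_iff_exists'.1 hb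
    exact ⟨i, j, h, rfl, rfl⟩

namespace JumpProtocol

open PointerJumping

variable {n k : ℕ}

/-- The pipes are arranged in `k` levels of `n` pipes each; the tap is on level `0`. -/
def level : Option (Fin (k * n)) → ℕ
  | none => 0
  | some i => (finProdFinEquiv.symm i).1 + 1

/-- The vertex that a pipe stands for. -/
def value (v₀ : Fin n) : Option (Fin (k * n)) → Fin n
  | none => v₀
  | some i => (finProdFinEquiv.symm i).2

theorem level_le (a : Option (Fin (k * n))) : level a ≤ k := by
  cases a with
  | none => exact Nat.zero_le _
  | some i => exact (finProdFinEquiv.symm i).1.isLt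

theorem ext_level_value (v₀ : Fin n) {a b : Option (Fin (k * n))} (h : level a = level b)
    (h' : value v₀ a = value v₀ b) : a = b := by
  cases a <;> cases b
  · rfl
  · simp [level] at h
  · simp [level] at h
  · exact congrArg some (finProdFinEquiv.symm.injective
      (Prod.ext (Fin.ext (Nat.succ_injective h)) h'))

theorem exists_level_value (v₀ v : Fin n) {j : ℕ} (hj : j < k) :
    ∃ a : Option (Fin (k * n)), level a = j + 1 ∧ value v₀ a = v :=
  ⟨some (finProdFinEquiv (⟨j, hj⟩, v)), by simp [level], by simp [value]⟩

/-- The pipe `b` continues the path from `a`. Pipes on the last level are only used if the path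
of length `k` has the right parity. -/
def Continues (v₀ : Fin n) (i : Bool) (f : Fin n ≃ Fin n) (a b : Option (Fin (k * n))) : Prop :=
  (level a).bodd = i ∧ level b = level a + 1 ∧ value v₀ b = f (value v₀ a) ∧
    (level b = k → xorBits (value v₀ b + 1) = k.bodd)

/-- The edges of the player `i` with input `f`. -/
def playerGraph (v₀ : Fin n) (i : Bool) (f : Fin n ≃ Fin n) :
    SimpleGraph (Option (Fin (k * n))) where
  Adj a b := Continues v₀ i f a b ∨ Continues v₀ i f b a
  symm := ⟨fun _ _ h => h.symm⟩
  loopless := ⟨fun a h => by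
    rcases h with h | h <;> exact absurd h.2.1 (by omega)⟩

theorem Continues.not_continues {v₀ : Fin n} {i : Bool} {f : Fin n ≃ Fin n}
    {a b c : Option (Fin (k * n))} (h : Continues v₀ i f a b) : ¬ Continues v₀ i f b c := by
  intro h'
  have := h'.1
  rw [h.2.1, Nat.bodd_succ, h.1] at this
  simp at this

theorem not_continues_of_level_eq {v₀ : Fin n} {j : ℕ} {f : Fin n ≃ Fin n}
    {a b : Option (Fin (k * n))} (ha : level a = j) : ¬ Continues v₀ j.bodd f b a := by
  intro h
  have h' := congrArg Nat.bodd (ha.symm.trans h.2.1)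
  rw [Nat.bodd_succ, h.1] at h'
  simp at h'

/-- A player's edges start on levels of one parity and end on levels of the other, so no pipe is
both a start and an end. Injectivity of `f` makes the start of an edge unique. -/
theorem playerGraph_isMatching (v₀ : Fin n) (i : Bool) (f : Fin n ≃ Fin n) :
    IsMatching (playerGraph (k := k) v₀ i f) := by
  rintro a b c (h | h) (h' | h')
  · exact ext_level_value v₀ (h.2.1.trans h'.2.1.symm) (h.2.2.1.trans h'.2.2.1.symm)
  · exact absurd h h'.not_continues
  · exact absurd h' h.not_continues
  · refine ext_level_value v₀ (Nat.succ_injective (h.2.1.symm.trans h'.2.1)) ?_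
    exact f.injective (h.2.2.1.symm.trans h'.2.2.1)

/-- The protocol that follows the pointers. -/
def protocol (k : ℕ) (v₀ : Fin n) : Protocol (Fin n ≃ Fin n) (Fin n ≃ Fin n) (k * n) where
  alice f := playerGraph v₀ false f
  bob f := (playerGraph v₀ true f).comap some
  alice_matching f := playerGraph_isMatching v₀ false f
  bob_matching f _ _ _ h h' :=
    Option.some_injective _ (playerGraph_isMatching v₀ true f _ _ _ h h')

variable (v₀ : Fin n) (f g : Fin n ≃ Fin n)

theorem playerGraph_true_adj_ne_none {a b : Option (Fin (k * n))}
    (h : (playerGraph v₀ true f).Adj a b) : a ≠ none := by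
  rintro rfl
  rcases h with h | h
  · exact absurd h.1 (by simp [level])
  · exact absurd h.2.1 (by simp [level])

theorem edges_protocol (j : ℕ) :
    (protocol k v₀).edges f g j = playerGraph v₀ j.bodd (inputs f g j.bodd) := by
  ext a b
  unfold Protocol.edges inputs protocol
  cases j.bodd
  · rfl
  · simp only [cond_true]
    rw [map_comap_some_adj]
    exact ⟨fun h => h.1, fun h =>
      ⟨h, playerGraph_true_adj_ne_none v₀ g h, playerGraph_true_adj_ne_none v₀ g h.symm⟩⟩

theorem flow_protocol {j : ℕ} (hj : j ≤ k)
    (hk : j = k → xorBits (pointer v₀ (inputs f g) k + 1) = k.bodd) :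
    ∃ a, (protocol k v₀).flow f g j = some a ∧ level a = j ∧
      value v₀ a = pointer v₀ (inputs f g) j := by
  induction j with
  | zero => exact ⟨none, rfl, rfl, rfl⟩
  | succ j ih =>
    obtain ⟨a, ha, hl, hv⟩ := ih (by omega) (fun h => by omega)
    obtain ⟨b, hbl, hbv⟩ := exists_level_value v₀ (pointer v₀ (inputs f g) (j + 1)) (j := j)
      (k := k) (by omega)
    refine ⟨b, (Protocol.flow_succ_eq_some _ f g).2 ⟨a, ha, ?_⟩, hbl, hbv⟩
    rw [edges_protocol]
    left
    refine ⟨by rw [hl], by rw [hl, hbl], ?_, fun h => ?_⟩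
    · rw [hbv, hv]
      rfl
    · rw [hbl] at h
      rw [hbv, h]
      exact hk h

/-- The water always reaches level `k - 1`; the condition in `Continues` decides about the last
edge. Since `k` and `k - 1` have opposite parities, the length encodes the answer. -/
theorem pathLength_protocol (hk : 1 ≤ k) :
    (protocol k v₀).pathLength f g =
      if xorBits (pointer v₀ (inputs f g) k + 1) = k.bodd then k else k - 1 := by
  split_ifs with h
  · obtain ⟨a, ha, hl, hv⟩ := flow_protocol v₀ f g (k := k) le_rfl (fun _ => h)
    refine Protocol.pathLength_eq ha ?_
    rw [Option.eq_none_iff_forall_ne_some]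
    intro b hb
    obtain ⟨a', ha', hab⟩ := (Protocol.flow_succ_eq_some _ f g).1 hb
    rw [ha, Option.some_inj] at ha'
    subst ha'
    rw [edges_protocol] at hab
    rcases hab with hab | hab
    · have := hab.2.1
      have := level_le b
      omega
    · exact not_continues_of_level_eq hl hab
  · obtain ⟨a, ha, hl, hv⟩ := flow_protocol v₀ f g (k := k) (j := k - 1) (by omega)
      (fun h => by omega)
    refine Protocol.pathLength_eq ha ?_
    rw [Option.eq_none_iff_forall_ne_some]
    intro b hb
    obtain ⟨a', ha', hab⟩ := (Protocol.flow_succ_eq_some _ f g).1 hb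
    rw [ha, Option.some_inj] at ha'
    subst ha'
    rw [edges_protocol] at hab
    rcases hab with hab | hab
    · have hb := hab.2.2.2 (by rw [hab.2.1, hl]; omega)
      rw [hab.2.2.1, hv] at hb
      apply h
      rw [← hb]
      obtain ⟨m, rfl⟩ := Nat.exists_eq_add_of_le' hk
      rfl
    · exact not_continues_of_level_eq hl hab

theorem computes_protocol (hk : 1 ≤ k) : (protocol k v₀).Computes (PJ k v₀) := by
  intro f g
  have heven : ∀ m : ℕ, Even m ↔ m.bodd = false := fun m => by
    rw [Nat.even_iff, Nat.mod_two_of_bodd]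
    cases m.bodd <;> simp
  rw [pathLength_protocol v₀ f g hk, PJ, number_jump_iterate, heven]
  obtain ⟨m, rfl⟩ := Nat.exists_eq_add_of_le' hk
  split_ifs with h
  · rw [h]
  · rw [Nat.bodd_succ] at h
    rw [Nat.add_sub_cancel]
    cases h1 : m.bodd <;> simp_all

theorem timeAtMost_protocol (hk : 1 ≤ k) : (protocol k v₀).TimeAtMost k := by
  intro f g
  rw [Protocol.ncard_wetPipes, pathLength_protocol v₀ f g hk]
  split_ifs <;> omega

end JumpProtocol

end GardenHose

/-! ### The adversary argument -/

namespace PointerJumping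

variable {n : ℕ} {T : Type*}

/-- What is fixed after `j` steps: the inputs are in `S`, with the values on `F` known, all
states up to step `j` and the `j`-th vertex are determined, but nothing much is known about the
next vertex. -/
structure Fixed (step : ℕ → (Fin n ≃ Fin n) → T → T) (t : T) (v₀ : Fin n) (M : ℝ) (j : ℕ)
    (S : Bool → Finset (Fin n ≃ Fin n)) (F : Bool → Finset (Fin n)) (v : Fin n) (τ : ℕ → T) :
    Prop where
  agree : ∀ i, AgreeOn (S i) (F i)
  spread : ∀ i, Spread (S i) (F i)
  weight : ∀ i, ((6 * M) ^ j)⁻¹ ≤ weight (S i) (F i)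
  pointer : ∀ z, (∀ i, z i ∈ S i) → pointer v₀ z j = v
  run : ∀ z, (∀ i, z i ∈ S i) → ∀ l ≤ j, run step t z l = τ l
  notMem : v ∉ F j.bodd

variable {step : ℕ → (Fin n ≃ Fin n) → T → T} {t : T} {v₀ : Fin n} {M : ℝ} {j : ℕ}
  {S : Bool → Finset (Fin n ≃ Fin n)} {F : Bool → Finset (Fin n)} {v : Fin n} {τ : ℕ → T}

theorem Fixed.nonempty (h : Fixed step t v₀ M j S F v τ) (hM : 1 ≤ M) (i : Bool) :
    (S i).Nonempty := by
  rw [Finset.nonempty_iff_ne_empty]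
  intro he
  have h1 := h.weight i
  have h2 : 0 < ((6 * M) ^ j)⁻¹ := by positivity
  rw [he] at h1
  simp only [PointerJumping.weight, Finset.card_empty, Nat.cast_zero, zero_mul, zero_div] at h1
  linarith

/-- The weight is at least `(6 * M) ^ (-j)` by the invariant and at most `(2/3) ^ |F|` by counting.
-/
theorem Fixed.card_lt (h : Fixed step t v₀ M j S F v τ) (hM : 1 ≤ M) {k N : ℕ} (hj : j ≤ k)
    (hN : (6 * M) ^ k < (3 / 2) ^ N) (i : Bool) : (F i).card < N := by
  by_contra hc
  have h1 := (h.weight i).trans (h.agree i).weight_le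
  have h2 : (2 / 3 : ℝ) ^ (F i).card ≤ (2 / 3) ^ N :=
    pow_le_pow_of_le_one (by norm_num) (by norm_num) (not_lt.1 hc)
  have h3 : (6 * M) ^ j ≤ (6 * M) ^ k := pow_le_pow_right₀ (by linarith) hj
  have h4 : ((3 / 2 : ℝ) ^ N)⁻¹ < ((6 * M) ^ j)⁻¹ := by
    have : 0 < (6 * M) ^ j := by positivity
    exact inv_strictAnti₀ this (by linarith)
  rw [← inv_pow] at h4
  norm_num at h4
  linarith

theorem exists_fixed_zero (step : ℕ → (Fin n ≃ Fin n) → T → T) (t : T) (v₀ : Fin n) (M : ℝ) :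
    ∃ S F v τ, Fixed step t v₀ M 0 S F v τ := by
  obtain ⟨S, -, F, h1, h2, h3⟩ := exists_spread (Finset.univ : Finset (Fin n ≃ Fin n)) ∅
    (fun _ _ _ _ v hv => absurd hv (Finset.notMem_empty v))
  have h4 : (1 : ℝ) ≤ weight S F := by
    refine le_trans (le_of_eq ?_) h3
    rw [weight, Finset.card_univ, Fintype.card_perm, Fintype.card_fin, Finset.card_empty, pow_zero,
      mul_one, Nat.sub_zero, div_self (by positivity)]
  -- The weight starts at 1, so not a single value can have been fixed; hence `v₀` is still free.
  have hF : F = ∅ := by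
    by_contra hne
    have h5 := h4.trans h1.weight_le
    have h6 : (2 / 3 : ℝ) ^ F.card < 1 := pow_lt_one₀ (by norm_num) (by norm_num)
      (Finset.card_ne_zero.2 (Finset.nonempty_iff_ne_empty.2 hne))
    linarith
  refine ⟨fun _ => S, fun _ => F, v₀, fun _ => t, fun _ => h1, fun _ => h2, fun _ => by simpa,
    fun _ _ => rfl, fun z _ l hl => ?_, by simp [hF]⟩
  obtain rfl : l = 0 := by omega
  rfl

/-- A value of `v` outside of `G`, and a reply, that reduce the weight only moderately. -/
theorem Spread.exists_reply [Fintype T] {S : Finset (Fin n ≃ Fin n)} {F G : Finset (Fin n)}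
    (hs : Spread S F) {v : Fin n} (hv : v ∉ F) (hG : 3 * G.card ≤ n - F.card)
    (hF : 2 * F.card ≤ n) (reply : (Fin n ≃ Fin n) → T) (hM : 1 ≤ (Fintype.card T : ℝ)) :
    ∃ w ∉ G, ∃ r, ∃ S' ⊆ fiber S v w, (∀ f ∈ S', reply f = r) ∧
      weight S F / (6 * Fintype.card T) ≤ weight S' (insert v F) := by
  classical
  obtain ⟨w, hw, hSw⟩ := hs.exists_fiber hv hG
  obtain ⟨r, -, hr⟩ := Finset.exists_le_card_fiber_of_nsmul_le_card_of_maps_to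
    (s := fiber S v w) (t := (Finset.univ : Finset T)) (f := reply)
    (b := ((fiber S v w).card : ℝ) / Fintype.card T)
    (fun _ _ => Finset.mem_univ _)
    (Finset.card_pos.1 (by rw [Finset.card_univ]; exact_mod_cast hM))
    (by rw [nsmul_eq_mul, Finset.card_univ, mul_div_cancel₀ _ (by positivity)])
  refine ⟨w, hw, r, _, Finset.filter_subset (fun f => reply f = r) _,
    fun f hf => (Finset.mem_filter.1 hf).2, ?_⟩
  set S' := (fiber S v w).filter fun f => reply f = r
  have hM0 : (0 : ℝ) < Fintype.card T := by linarith
  rw [div_le_iff₀ hM0] at hr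
  have hSw' : (S.card : ℝ) ≤ 2 * n * (fiber S v w).card := by exact_mod_cast hSw
  have hn : (n : ℝ) ≤ 2 * (n - F.card : ℕ) := by exact_mod_cast (by omega : n ≤ 2 * (n - F.card))
  -- Fixing the value costs a factor `2 * n` and the reply a factor `|T|`. The weight regains `2 / 3
  -- * (n - |F|)`, which is at least `n / 3`; this leaves `6 * |T|`.
  have hS : (S.card : ℝ) ≤ S'.card * (2 / 3 * (n - F.card : ℕ)) * (6 * Fintype.card T) := by
    calc (S.card : ℝ) ≤ 2 * n * (fiber S v w).card := hSw'
      _ ≤ 2 * (2 * (n - F.card : ℕ)) * (S'.card * Fintype.card T) := by gcongr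
      _ = _ := by ring
  rw [weight_insert hv, weight, div_le_iff₀ (by positivity)]
  calc (S.card : ℝ) * (2 / 3) ^ F.card / (n - F.card).factorial
      ≤ (S'.card * (2 / 3 * (n - F.card : ℕ)) * (6 * Fintype.card T)) * (2 / 3) ^ F.card /
          (n - F.card).factorial := by gcongr
    _ = _ := by ring

theorem Fixed.exists_succ [Fintype T] (h : Fixed step t v₀ (Fintype.card T) j S F v τ)
    (hM : 1 ≤ (Fintype.card T : ℝ)) (hF : ∀ i, 4 * (F i).card ≤ n) :
    ∃ S F v τ, Fixed step t v₀ (Fintype.card T) (j + 1) S F v τ := by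
  have hF1 := hF j.bodd
  have hF2 := hF !j.bodd
  -- Taking the other player's `F` as the forbidden set keeps the new vertex free for the player who
  -- moves next.
  obtain ⟨w, hw, r, S₁, hS₁, hr, hweight⟩ := (h.spread j.bodd).exists_reply h.notMem
    (G := F !j.bodd) (by omega) (by omega) (fun f => step j f (τ j)) hM
  obtain ⟨S₂, hS₂, F₂, h1, h2, h3⟩ := exists_spread S₁ (insert v (F j.bodd))
    (((h.agree _).fiber v w).mono hS₁)
  have hsub : ∀ f ∈ S₂, f ∈ S j.bodd ∧ f v = w := fun f hf =>
    Finset.mem_filter.1 (hS₁ (hS₂ hf))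
  have hz : ∀ z : Bool → (Fin n ≃ Fin n), (∀ i, z i ∈ Function.update S j.bodd S₂ i) →
      (∀ i, z i ∈ S i) ∧ z j.bodd ∈ S₂ := by
    intro z hz
    have hzj : z j.bodd ∈ S₂ := by simpa using hz j.bodd
    refine ⟨fun i => ?_, hzj⟩
    by_cases hi : i = j.bodd
    · rw [hi]
      exact (hsub _ hzj).1
    · simpa [hi] using hz i
  have hle : ((6 * (Fintype.card T : ℝ)) ^ (j + 1))⁻¹ ≤ ((6 * (Fintype.card T : ℝ)) ^ j)⁻¹ :=
    inv_anti₀ (by positivity) (pow_le_pow_right₀ (by linarith) (by omega))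
  refine ⟨Function.update S j.bodd S₂, Function.update F j.bodd F₂, w,
    Function.update τ (j + 1) r, fun i => ?_, fun i => ?_, fun i => ?_, fun z hzS => ?_,
    fun z hzS l hl => ?_, ?_⟩
  · by_cases hi : i = j.bodd
    · subst hi
      simpa using h1
    · simpa [hi] using h.agree i
  · by_cases hi : i = j.bodd
    · subst hi
      simpa using h2
    · simpa [hi] using h.spread i
  · by_cases hi : i = j.bodd
    · subst hi
      simp only [Function.update_self]
      refine le_trans ?_ (hweight.trans h3)
      rw [pow_succ, mul_inv, ← div_eq_mul_inv]
      gcongr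
      exact h.weight _
    · simpa [hi] using hle.trans (h.weight i)
  · obtain ⟨hzS', hzj⟩ := hz z hzS
    have := h.pointer z hzS'
    rw [PointerJumping.pointer, PointerJumping.run, ← PointerJumping.pointer, this]
    exact (hsub _ hzj).2
  · obtain ⟨hzS', hzj⟩ := hz z hzS
    by_cases hl' : l = j + 1
    · subst hl'
      rw [Function.update_self, PointerJumping.run, h.run z hzS' j le_rfl]
      exact hr _ (hS₂ hzj)
    · rw [Function.update_of_ne hl']
      exact h.run z hzS' l (by omega)
  · rw [Nat.bodd_succ, Function.update_of_ne (by simp)]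
    exact hw

/-- A computation with `k` short messages does not determine the parity of the vertex reached
after `k + 1` jumps. -/
theorem exists_run_eq_and_xorBits_ne [Fintype T] (step : ℕ → (Fin n ≃ Fin n) → T → T) (t : T)
    (v₀ : Fin n) {k N : ℕ} (hn : 20 ≤ n) (hNn : 20 * N ≤ n)
    (hN : (6 * (Fintype.card T : ℝ)) ^ k < (3 / 2) ^ N) :
    ∃ z z', (∀ l ≤ k, run step t z l = run step t z' l) ∧
      xorBits (pointer v₀ z (k + 1) + 1) ≠ xorBits (pointer v₀ z' (k + 1) + 1) := by
  have hM : 1 ≤ (Fintype.card T : ℝ) := by exact_mod_cast Fintype.card_pos_iff.2 ⟨t⟩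
  have key : ∀ j ≤ k, ∃ S F v τ, Fixed step t v₀ (Fintype.card T) j S F v τ := by
    intro j
    induction j with
    | zero => exact fun _ => exists_fixed_zero step t v₀ _
    | succ j ih =>
      intro hj
      obtain ⟨S, F, v, τ, h⟩ := ih (by omega)
      refine h.exists_succ hM fun i => ?_
      have := h.card_lt hM (by omega : j ≤ k) hN i
      omega
  obtain ⟨S, F, v, τ, h⟩ := key k le_rfl
  have hF := h.card_lt hM le_rfl hN k.bodd
  choose g hg using h.nonempty hM
  have hx : ∀ b, ∃ z, (∀ i, z i ∈ S i) ∧ xorBits (pointer v₀ z (k + 1) + 1) = b := by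
    intro b
    obtain ⟨f, hf, hb⟩ := (h.spread k.bodd).exists_xorBits h.notMem (by omega) hn b
    have hz : ∀ i, Function.update g k.bodd f i ∈ S i := by
      intro i
      by_cases hi : i = k.bodd
      · subst hi
        simpa using hf
      · simpa [hi] using hg i
    refine ⟨_, hz, ?_⟩
    have := h.pointer _ hz
    rw [PointerJumping.pointer, PointerJumping.run, ← PointerJumping.pointer, this,
      Function.update_self]
    exact hb
  obtain ⟨z, hz, hzx⟩ := hx true
  obtain ⟨z', hz', hzx'⟩ := hx false
  exact ⟨z, z', fun l hl => (h.run z hz l hl).trans (h.run z' hz' l hl).symm, by simp [hzx, hzx']⟩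

end PointerJumping

/-! ### The lower bound for protocols -/

namespace GardenHose.Protocol

open PointerJumping

theorem flow_eq_run {I : Type*} {s : ℕ} (P : Protocol I I s) (z : Bool → I) (j : ℕ) :
    P.flow (z false) (z true) j =
      run (fun j f t => t.bind (partner (bif j.bodd then (P.bob f).map Function.Embedding.some
        else P.alice f))) (some none) z j := by
  induction j with
  | zero => rfl
  | succ j ih =>
    rw [flow, run, ih, edges]
    cases j.bodd <;> rfl

theorem pow_le_size_of_computes {n k s N : ℕ} {v₀ : Fin n}
    {P : Protocol (Fin n ≃ Fin n) (Fin n ≃ Fin n) s} (hP : P.Computes (PJ (k + 1) v₀))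
    (hT : P.TimeAtMost k) (hn : 20 ≤ n) (hN : 20 * N ≤ n) :
    (3 / 2 : ℝ) ^ N ≤ (6 * (s + 2)) ^ k := by
  by_contra hlt
  push Not at hlt
  obtain ⟨z, z', hrun, hne⟩ := exists_run_eq_and_xorBits_ne (T := Option (Option (Fin s)))
    (fun j f t => t.bind (partner (bif j.bodd then (P.bob f).map Function.Embedding.some
        else P.alice f))) (some none) v₀ (k := k) hn hN (by
      simp only [Fintype.card_option, Fintype.card_fin]
      push_cast
      rwa [add_assoc, one_add_one_eq_two])
  have hflow : ∀ l ≤ k, P.flow (z false) (z true) l = P.flow (z' false) (z' true) l := by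
    intro l hl
    rw [flow_eq_run, flow_eq_run, hrun l hl]
  have hlen : P.pathLength (z false) (z true) = P.pathLength (z' false) (z' true) := by
    have h1 := hT (z false) (z true)
    have h2 := hT (z' false) (z' true)
    rw [ncard_wetPipes] at h1 h2
    have key : ∀ l ≤ k, P.pathLength (z false) (z true) < l ↔
        P.pathLength (z' false) (z' true) < l := fun l hl => by
      rw [← flow_eq_none_iff, ← flow_eq_none_iff, hflow l hl]
    -- Both lengths are at most `k`, so a difference would already show within the first `k` steps,
    -- where the flows agree.
    rcases lt_trichotomy (P.pathLength (z false) (z true)) (P.pathLength (z' false) (z' true))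
      with h | h | h
    · have := (key _ h2).1 h
      omega
    · exact h
    · have := (key _ h1).2 h
      omega
  have hz : ∀ z : Bool → (Fin n ≃ Fin n), inputs (z false) (z true) = z := by
    intro z
    ext i
    cases i <;> rfl
  have h1 := hP (z false) (z true)
  have h2 := hP (z' false) (z' true)
  rw [PJ, number_jump_iterate, hz] at h1 h2
  rw [hlen] at h1
  apply hne
  have h3 := h1.symm.trans h2
  cases h4 : xorBits (pointer v₀ z (k + 1) + 1) <;>
    cases h5 : xorBits (pointer v₀ z' (k + 1) + 1) <;> simp_all

end GardenHose.Protocol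

/-! ### Numerical estimates and conclusion -/

theorem two_rpow_le_size {n k s : ℕ} (hn : 2 ≤ n) (hk : 1 ≤ k)
    (hkn : (k : ℝ) ≤ (n : ℝ) / (100 * Real.logb 2 (n : ℝ)))
    (h : ∀ N : ℕ, 20 * N ≤ n → 20 ≤ n → (3 / 2 : ℝ) ^ N ≤ (6 * (s + 2)) ^ (k - 1)) :
    (2 : ℝ) ^ (1 / 100 * ((n : ℝ) / (k : ℝ))) ≤ (s : ℝ) := by
  have hn0 : (2 : ℝ) ≤ n := by exact_mod_cast hn
  have hk0 : (1 : ℝ) ≤ k := by exact_mod_cast hk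
  have hlog1 : 1 ≤ Real.logb 2 n := by
    rw [Real.le_logb_iff_rpow_le (by norm_num) (by linarith)]
    simpa using hn0
  rw [le_div_iff₀ (by linarith)] at hkn
  have hn1 : (100 : ℝ) ≤ n := by nlinarith
  have hlog2 : 6 ≤ Real.logb 2 n := by
    rw [Real.le_logb_iff_rpow_le (by norm_num) (by linarith)]
    have : 100 ≤ n := by exact_mod_cast hn1
    norm_num
    omega
  -- From here on, the bound on `k` enters only in this form.
  have hkn' : 600 * (k : ℝ) ≤ n := by nlinarith
  by_contra hs
  push Not at hs
  set r : ℝ := n / k with hr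
  have hrk : r * k = n := by rw [hr]; field_simp
  have hn20 : 20 ≤ n := by
    have : (20 : ℝ) ≤ n := by linarith
    exact_mod_cast this
  have hN := h (n / 20) (Nat.mul_div_le n 20) hn20
  have hbase : 6 * ((s : ℝ) + 2) ≤ (2 : ℝ) ^ (5 + 1 / 100 * r) := by
    rw [Real.rpow_add (by norm_num)]
    have h1 : (1 : ℝ) ≤ 2 ^ (1 / 100 * r) := Real.one_le_rpow (by norm_num) (by positivity)
    have h2 : (2 : ℝ) ^ (5 : ℝ) = 32 := by norm_num
    rw [h2]
    linarith
  have h1 : (6 * ((s : ℝ) + 2)) ^ (k - 1) ≤ (2 : ℝ) ^ ((5 + 1 / 100 * r) * k) := by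
    rw [Real.rpow_mul (by norm_num), Real.rpow_natCast]
    have h0 : (0 : ℝ) ≤ s := s.cast_nonneg
    calc (6 * ((s : ℝ) + 2)) ^ (k - 1) ≤ (6 * ((s : ℝ) + 2)) ^ k :=
          pow_le_pow_right₀ (by linarith) (by omega)
      _ ≤ _ := by gcongr
  -- Since `√2 ≤ 3/2`, comparing exponents of 2 gives `⌊n/20⌋ / 2 ≤ 5 * k + n / 100`, which fails
  -- for `600 * k ≤ n`.
  have h2 : (2 : ℝ) ^ ((1 / 2 : ℝ) * (n / 20 : ℕ)) ≤ (3 / 2 : ℝ) ^ (n / 20) := by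
    rw [Real.rpow_mul (by norm_num), Real.rpow_natCast]
    gcongr
    rw [← Real.sqrt_eq_rpow, Real.sqrt_le_left (by norm_num)]
    norm_num
  have h3 := (Real.rpow_le_rpow_left_iff (by norm_num : (1 : ℝ) < 2)).1 (h2.trans (hN.trans h1))
  have h4 : (n : ℝ) < 20 * ((n / 20 : ℕ) + 1) := by
    exact_mod_cast (by omega : n < 20 * (n / 20 + 1))
  nlinarith

theorem mainTheorem9 :
    (∀ (n k : ℕ) (v₀ : Fin n), 1 ≤ k →
      ∃ P : GardenHose.Protocol (Fin n ≃ Fin n) (Fin n ≃ Fin n) (k * n),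
        P.Computes (PointerJumping.PJ k v₀) ∧ P.TimeAtMost k) ∧
    (∃ c : ℝ, 0 < c ∧
      ∀ (n k s : ℕ) (v₀ : Fin n)
        (P : GardenHose.Protocol (Fin n ≃ Fin n) (Fin n ≃ Fin n) s),
        2 ≤ n → 1 ≤ k → (k : ℝ) ≤ (n : ℝ) / (100 * Real.logb 2 (n : ℝ)) →
        P.Computes (PointerJumping.PJ k v₀) → P.TimeAtMost (k - 1) →
        (2 : ℝ) ^ (c * ((n : ℝ) / (k : ℝ))) ≤ (s : ℝ)) := by
  refine ⟨fun n k v₀ hk => ⟨GardenHose.JumpProtocol.protocol k v₀,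
    GardenHose.JumpProtocol.computes_protocol v₀ hk,
    GardenHose.JumpProtocol.timeAtMost_protocol v₀ hk⟩, 1 / 100, by norm_num, ?_⟩
  intro n k s v₀ P hn hk hkn hP hT
  refine two_rpow_le_size hn hk hkn fun N hN hn20 => ?_
  obtain ⟨m, rfl⟩ := Nat.exists_eq_add_of_le' hk
  exact GardenHose.Protocol.pow_le_size_of_computes hP hT hn20 hN
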